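/- Let $(\xi_n)_{n\ge 1}$ be i.i.d. random variables with values in a countable group $G$ with identity $e$, and let $S_0=e$ almost surely, $S_n=\xi_1\xi_2\cdots\xi_n$ for $n\ge 1$. Assume that the random walk $(S_n)_{n\ge 0}$ is transient, i.e. that $$\gamma=P(S_n\neq e\ \text{ for all } n\ge 1)>0 .$$ For $n\ge 0$ and $x\in G$ let $\ell(n,x)=\sum_{i=0}^{n}\mathbb{I}_{(S_i=x)}$ be the local time at $x$. Let $f:\{0,1,2,\dots\}\to\mathbb{R}$ satisfy $f(0)=0$ and $$\sum_{j=1}^{\infty}\frac{f(j)^2(1-\gamma)^j}{j}<\infty ,$$ and put $G_n(f)=\sum_{x\in G}f(\ell(n-1,x))$ for $n\ge 1$. Then the series $\sum_{j=1}^{\infty}f(j)(1-\gamma)^{j-1}$ converges absolutely (with the convention $0^0=1$), $G_n(f)/n$ is square integrable for every $n\ge1$, and $$\frac{1}{n}G_n(f)\longrightarrow \gamma^2\sum_{j=1}^{\infty}f(j)(1-\gamma)^{j-1}\quad\text{in } L^2 \text{ as } n\to\infty .$$ -/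

import Mathlib

open MeasureTheory ProbabilityTheory Filter Topology

/-- `walkIncrement S n` is the increment `ξ_{n+1} = S_n⁻¹ S_{n+1}` of a process on a group. -/
def walkIncrement {Ω G : Type*} [Group G] (S : ℕ → Ω → G) (n : ℕ) (ω : Ω) : G :=
  (S n ω)⁻¹ * S (n + 1) ω

/-- `S` is a random walk on the group `G` under `P`: it starts almost surely at the identity, and
its increments `ξ_1, ξ_2, …` are independent and identically distributed `G`-valued
random variables. -/
structure IsGroupRandomWalk {Ω G : Type*} [MeasurableSpace Ω] [Group G] [MeasurableSpace G]
    (P : Measure Ω) (S : ℕ → Ω → G) : Prop where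
  measurable : ∀ n, Measurable (S n)
  start : ∀ᵐ ω ∂P, S 0 ω = 1
  indep : iIndepFun (fun n => walkIncrement S n) P
  identDistrib : ∀ n, IdentDistrib (walkIncrement S n) (walkIncrement S 0) P P

/-- The escape probability `γ = P(S_n ≠ e for all n ≥ 1)`. -/
noncomputable def escapeProb {Ω G : Type*} [MeasurableSpace Ω] [Group G]
    (P : Measure Ω) (S : ℕ → Ω → G) : ℝ :=
  P.real {ω | ∀ n : ℕ, 1 ≤ n → S n ω ≠ 1}

open Classical in
/-- `localTimeBefore S n x ω` is the local time `ℓ(n - 1, x) = ∑_{i=0}^{n-1} 1_{S_i = x}`, with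
`ℓ(-1, x) = 0`. -/
noncomputable def localTimeBefore {Ω G : Type*} (S : ℕ → Ω → G) (n : ℕ) (x : G) (ω : Ω) : ℕ :=
  ∑ i ∈ Finset.range n, if S i ω = x then 1 else 0

/-- `G_n(f) = ∑_{x ∈ G} f(ℓ(n - 1, x))`. For `f 0 = 0` only the finitely many sites visited before
time `n` contribute, so that this is a finite sum. -/
noncomputable def localTimeFunctional {Ω G : Type*} (S : ℕ → Ω → G) (f : ℕ → ℝ) (n : ℕ)
    (ω : Ω) : ℝ :=
  ∑ᶠ x : G, f (localTimeBefore S n x ω)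

/-! Visits to a site, read backwards in time, run through the local times 1, 2, .... Hence for F
with `F 0 = 0` the site sum telescopes into a time sum: G_n(F) = ∑_{i<n} (F(L_i + 1) - F(L_i)),
where L_i (`laterVisits`) counts the returns to S_i strictly between times i and n. By left
invariance L_i depends only on the increments after time i.

Write q = 1 - γ. Decomposing at the first return shows that a walk started afresh returns at least b
times with probability q^b (`measureReal_returnsAtLeast`). For fixed a, the event that at least a
returns ever follow time i is, up to small probability, decided within m steps, and is then
independent of what happens after time i + m. A second moment estimate therefore gives #{i < n : L_i
≥ a}/n → q^a in L² (`tendsto_eLpNorm_countLaterVisits`). The number of sites visited exactly a + 1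
times is a second difference in a of these counts, so its density is q^a - 2q^(a+1) + q^(a+2) = γ²
q^a. This settles finitely supported f by linearity.

For general f the tail is controlled uniformly in n. Cauchy–Schwarz over sites with weights ℓ,
together with ∑ ℓ = n, bounds (G_n(F)/n)² by an average over time of F(L_i + 1)²/(L_i + 1), whose
mean is at most ∑_b F(b + 1)² q^b/(b + 1) (`eLpNorm_localTimeFunctional_le`). The summability
hypothesis makes this small for the part of f beyond a large cutoff. -/

/-- The product `s_0 s_1 ⋯ s_{k-1}` of the first `k` letters of a sequence in a group. -/
def wordProd {G : Type*} [Group G] (s : ℕ → G) : ℕ → G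
  | 0 => 1
  | k + 1 => wordProd s k * s k

/-- The sequence `s` without its first `i` letters. -/
def shiftSeq {G : Type*} (i : ℕ) (s : ℕ → G) (j : ℕ) : G := s (i + j)

/-- The number of `k` in `{1, …, m}` with `s_0 ⋯ s_{k-1} = 1`. -/
noncomputable def returnCount {G : Type*} [Group G] (m : ℕ) (s : ℕ → G) : ℕ :=
  localTimeBefore (fun k (s : ℕ → G) => wordProd s (k + 1)) m 1 s

/-! ### Pathwise identities for local times and return counts -/

section Deterministic

variable {G : Type*}

lemma shiftSeq_shiftSeq (i j : ℕ) (s : ℕ → G) :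
    shiftSeq j (shiftSeq i s) = shiftSeq (i + j) s := by
  ext k
  simp [shiftSeq, add_assoc]

open Classical in
lemma localTimeBefore_succ {Ω : Type*} (S : ℕ → Ω → G) (n : ℕ) (x : G) (ω : Ω) :
    localTimeBefore S (n + 1) x ω =
      localTimeBefore S n x ω + if S n ω = x then 1 else 0 := by
  unfold localTimeBefore
  rw [Finset.sum_range_succ]

open Classical in
lemma localTimeBefore_succ' {Ω : Type*} (S : ℕ → Ω → G) (n : ℕ) (x : G) (ω : Ω) :
    localTimeBefore S (n + 1) x ω =
      localTimeBefore (fun k => S (k + 1)) n x ω + if S 0 ω = x then 1 else 0 := by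
  unfold localTimeBefore
  rw [Finset.sum_range_succ']

lemma localTimeBefore_mono {Ω : Type*} (S : ℕ → Ω → G) (x : G) (ω : Ω) :
    Monotone fun n => localTimeBefore S n x ω :=
  monotone_nat_of_le_succ fun n => by rw [localTimeBefore_succ]; omega

lemma localTimeBefore_le {Ω : Type*} (S : ℕ → Ω → G) (n : ℕ) (x : G) (ω : Ω) :
    localTimeBefore S n x ω ≤ n := by
  induction n with
  | zero => simp [localTimeBefore]
  | succ n ih => rw [localTimeBefore_succ]; split_ifs <;> omega

lemma localTimeBefore_congr {Ω Ω' : Type*} {S : ℕ → Ω → G} {T : ℕ → Ω' → G} {n : ℕ} {x y : G}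
    {ω : Ω} {ω' : Ω'} (h : ∀ i < n, S i ω = x ↔ T i ω' = y) :
    localTimeBefore S n x ω = localTimeBefore T n y ω' := by
  classical
  refine Finset.sum_congr rfl fun i hi => ?_
  simp [h i (Finset.mem_range.1 hi)]

lemma localTimeBefore_eq_zero {Ω : Type*} {S : ℕ → Ω → G} {n : ℕ} {x : G} {ω : Ω}
    (h : ∀ i < n, S i ω ≠ x) : localTimeBefore S n x ω = 0 := by
  classical
  exact Finset.sum_eq_zero fun i hi => if_neg (h i (Finset.mem_range.1 hi))

/-- A sum over the sites of a function of the local time, as a sum over time: visits to a site,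
taken backwards in time, run through the increments of the function. -/
lemma sum_localTimeBefore {Ω : Type*} (F : ℕ → ℝ) (hF : F 0 = 0) (n : ℕ) (S : ℕ → Ω → G)
    (ω : Ω) (T : Finset G) (hT : ∀ i < n, S i ω ∈ T) :
    ∑ x ∈ T, F (localTimeBefore S n x ω) = ∑ i ∈ Finset.range n,
      (F (localTimeBefore (fun k => S (i + 1 + k)) (n - 1 - i) (S i ω) ω + 1) -
        F (localTimeBefore (fun k => S (i + 1 + k)) (n - 1 - i) (S i ω) ω)) := by
  classical
  induction n generalizing S with
  | zero => simp [localTimeBefore, hF]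
  | succ n ih =>
    have h0 : S 0 ω ∈ T := hT 0 (by omega)
    -- Deleting time 0 lowers the local time by one at the site `S 0 ω` and nowhere else, so the sum
    -- changes by a single increment of `F`.
    have key : ∀ x ∈ T, F (localTimeBefore S (n + 1) x ω) =
        F (localTimeBefore (fun k => S (k + 1)) n x ω) + if S 0 ω = x then
          F (localTimeBefore (fun k => S (k + 1)) n (S 0 ω) ω + 1) -
            F (localTimeBefore (fun k => S (k + 1)) n (S 0 ω) ω) else 0 := by
      intro x _
      rw [localTimeBefore_succ']
      split_ifs with h
      · subst h; ring
      · simp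
    rw [Finset.sum_congr rfl key, Finset.sum_add_distrib, Finset.sum_ite_eq, if_pos h0,
      ih (fun k => S (k + 1)) fun i hi => hT (i + 1) (by omega), Finset.sum_range_succ']
    congr 1
    · refine Finset.sum_congr rfl fun i _ => ?_
      have h1 : (fun k => S (i + 1 + 1 + k)) = fun k => S (i + 1 + k + 1) := by
        ext k; congr 1; omega
      rw [h1, show n + 1 - 1 - (i + 1) = n - 1 - i by omega]
    · have h1 : (fun k => S (0 + 1 + k)) = fun k => S (k + 1) := by
        ext k; congr 1; omega
      rw [h1]
      simp

open Classical in
lemma localTimeFunctional_eq_sum_image {Ω : Type*} (S : ℕ → Ω → G) (F : ℕ → ℝ) (hF : F 0 = 0)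
    (n : ℕ) (ω : Ω) : localTimeFunctional S F n ω =
      ∑ x ∈ (Finset.range n).image (fun i => S i ω), F (localTimeBefore S n x ω) := by
  refine finsum_eq_sum_of_support_subset _ fun x hx => ?_
  by_contra hx'
  refine hx ?_
  dsimp only
  rw [localTimeBefore_eq_zero, hF]
  intro i hi h
  exact hx' (by simpa using ⟨i, hi, h⟩)

variable [Group G]

lemma wordProd_add (s : ℕ → G) (k l : ℕ) :
    wordProd s (k + l) = wordProd s k * wordProd (shiftSeq k s) l := by
  induction l with
  | zero => simp [wordProd]
  | succ l ih => rw [← add_assoc, wordProd, ih, wordProd, shiftSeq, mul_assoc]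

lemma wordProd_congr {s t : ℕ → G} {k : ℕ} (h : ∀ j < k, s j = t j) :
    wordProd s k = wordProd t k := by
  induction k with
  | zero => rfl
  | succ k ih => rw [wordProd, wordProd, ih fun j hj => h j (by omega), h k (by omega)]

lemma wordProd_walkIncrement {Ω : Type*} (S : ℕ → Ω → G) (ω : Ω) (i k : ℕ) :
    S i ω * wordProd (shiftSeq i fun j => walkIncrement S j ω) k = S (i + k) ω := by
  induction k with
  | zero => simp [wordProd]
  | succ k ih =>
    rw [wordProd, ← mul_assoc, ih]
    simp [shiftSeq, walkIncrement, add_assoc]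

lemma returnCount_mono (s : ℕ → G) : Monotone fun m => returnCount m s :=
  localTimeBefore_mono _ _ _

lemma returnCount_le (m : ℕ) (s : ℕ → G) : returnCount m s ≤ m :=
  localTimeBefore_le _ _ _ _

lemma returnCount_zero (s : ℕ → G) : returnCount 0 s = 0 := by
  simp [returnCount, localTimeBefore]

open Classical in
lemma returnCount_succ (m : ℕ) (s : ℕ → G) :
    returnCount (m + 1) s = returnCount m s + if wordProd s (m + 1) = 1 then 1 else 0 :=
  localTimeBefore_succ _ _ _ _

lemma returnCount_congr {s t : ℕ → G} {m : ℕ} (h : ∀ j < m, s j = t j) :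
    returnCount m s = returnCount m t :=
  localTimeBefore_congr fun i hi => by
    rw [wordProd_congr fun j hj => h j (by omega)]

/-- Left multiplication by S_i identifies returns of the shifted word to the identity with later
visits to S_i; thus the starting site plays no role in the count. -/
lemma returnCount_walkIncrement {Ω : Type*} (S : ℕ → Ω → G) (ω : Ω) (i m : ℕ) :
    returnCount m (shiftSeq i fun j => walkIncrement S j ω) =
      localTimeBefore (fun k => S (i + 1 + k)) m (S i ω) ω :=
  localTimeBefore_congr fun k _ => by
    have h := wordProd_walkIncrement S ω i (k + 1)
    rw [show i + 1 + k = i + (k + 1) by omega, ← h]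
    simp

/-- After a return at time `k`, the visits start afresh. -/
lemma returnCount_add_of_wordProd_eq_one {s : ℕ → G} {k : ℕ} (hk : wordProd s k = 1) (m : ℕ) :
    returnCount (k + m) s = returnCount k s + returnCount m (shiftSeq k s) := by
  induction m with
  | zero => simp [returnCount_zero]
  | succ m ih =>
    rw [← add_assoc, returnCount_succ, ih, returnCount_succ, add_assoc k m 1, wordProd_add, hk,
      one_mul, add_assoc]

/-- The number of returns, strictly between times `i` and `n`, to the site visited at time `i`. -/
noncomputable def laterVisits {Ω : Type*} (S : ℕ → Ω → G) (n i : ℕ) (ω : Ω) : ℕ :=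
  returnCount (n - 1 - i) (shiftSeq i fun j => walkIncrement S j ω)

lemma localTimeFunctional_eq_sum {Ω : Type*} (S : ℕ → Ω → G) (F : ℕ → ℝ) (hF : F 0 = 0)
    (n : ℕ) (ω : Ω) : localTimeFunctional S F n ω =
      ∑ i ∈ Finset.range n, (F (laterVisits S n i ω + 1) - F (laterVisits S n i ω)) := by
  classical
  rw [localTimeFunctional_eq_sum_image S F hF, sum_localTimeBefore F hF n S ω _ (fun i hi =>
    Finset.mem_image_of_mem (fun i => S i ω) (Finset.mem_range.2 hi))]
  simp only [laterVisits, returnCount_walkIncrement]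

lemma laterVisits_lt {Ω : Type*} (S : ℕ → Ω → G) {n i : ℕ} (hi : i < n) (ω : Ω) :
    laterVisits S n i ω < n :=
  (returnCount_le _ _).trans_lt (by omega)

/-- The Cauchy–Schwarz bound for the local time functional. -/
lemma localTimeFunctional_sq_le {Ω : Type*} (S : ℕ → Ω → G) (F : ℕ → ℝ) (hF : F 0 = 0)
    (n : ℕ) (ω : Ω) : localTimeFunctional S F n ω ^ 2 ≤ n * ∑ i ∈ Finset.range n,
      F (laterVisits S n i ω + 1) ^ 2 / (laterVisits S n i ω + 1 : ℕ) := by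
  classical
  have hid := localTimeFunctional_eq_sum S (fun j => (j : ℝ)) (by simp) n ω
  have hsq := localTimeFunctional_eq_sum S (fun j => F j ^ 2 / j) (by simp) n ω
  rw [localTimeFunctional_eq_sum_image S _ (by simp)] at hid hsq
  rw [localTimeFunctional_eq_sum_image S F hF]
  -- Cauchy–Schwarz from F(ℓ)² = ℓ · (F(ℓ)²/ℓ). Both factors are themselves local time functionals:
  -- the first sums to n, and the time sum for the second is bounded by dropping its subtracted
  -- terms.
  refine (Finset.sum_sq_le_sum_mul_sum_of_sq_le_mul _ (fun x _ => Nat.cast_nonneg _)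
    (g := fun x => F (localTimeBefore S n x ω) ^ 2 / (localTimeBefore S n x ω : ℝ))
    (fun x _ => by positivity) (f := fun x => (localTimeBefore S n x ω : ℝ))
    fun x _ => ?_).trans ?_
  · refine le_of_eq ?_
    rcases Nat.eq_zero_or_pos (localTimeBefore S n x ω) with h | h
    · simp [h, hF]
    · field_simp
  · rw [hid, hsq]
    simp only [Nat.cast_add, Nat.cast_one, add_sub_cancel_left, Finset.sum_const,
      Finset.card_range, nsmul_eq_mul, mul_one]
    gcongr with i
    exact sub_le_self _ (by positivity)

end Deterministic

/-! ### Stationarity, independence and the geometric law of returns -/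

section Law

variable {Ω G : Type*} [MeasurableSpace Ω] [Group G] [Countable G] [MeasurableSpace G]
  [DiscreteMeasurableSpace G] {P : Measure Ω} {S : ℕ → Ω → G}

lemma measurable_shiftSeq {G : Type*} [MeasurableSpace G] (i : ℕ) :
    Measurable (shiftSeq i : (ℕ → G) → ℕ → G) :=
  measurable_pi_lambda _ fun _ => measurable_pi_apply _

lemma measurable_wordProd (k : ℕ) : Measurable fun s : ℕ → G => wordProd s k := by
  induction k with
  | zero => exact measurable_const
  | succ k ih =>
    exact (Measurable.of_discrete (f := fun p : G × G => p.1 * p.2)).comp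
      (ih.prodMk (measurable_pi_apply k))

lemma measurable_returnCount (m : ℕ) : Measurable (returnCount m : (ℕ → G) → ℕ) := by
  classical
  induction m with
  | zero =>
    have : (returnCount 0 : (ℕ → G) → ℕ) = fun _ => 0 := funext returnCount_zero
    rw [this]
    exact measurable_const
  | succ m ih =>
    have : (returnCount (m + 1) : (ℕ → G) → ℕ) =
        fun s => returnCount m s + if wordProd s (m + 1) = 1 then 1 else 0 :=
      funext (returnCount_succ m)
    rw [this]
    exact ih.add (Measurable.ite (measurable_wordProd _ (MeasurableSet.of_discrete (s := {1})))
      measurable_const measurable_const)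

lemma measurable_pi_of_comap_le {Ω G : Type*} [MeasurableSpace G] {m : MeasurableSpace Ω}
    {X : Ω → ℕ → G} (h : ∀ j, MeasurableSpace.comap (fun ω => X ω j) inferInstance ≤ m) :
    Measurable[m] X :=
  measurable_pi_lambda _ fun j => measurable_iff_comap_le.2 (h j)

namespace IsGroupRandomWalk

lemma measurable_walkIncrement (hS : IsGroupRandomWalk P S) (n : ℕ) :
    Measurable (walkIncrement S n) :=
  (Measurable.of_discrete (f := fun p : G × G => p.1⁻¹ * p.2)).comp
    ((hS.measurable n).prodMk (hS.measurable (n + 1)))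

lemma measurable_increments (hS : IsGroupRandomWalk P S) :
    Measurable fun ω j => walkIncrement S j ω :=
  measurable_pi_lambda _ hS.measurable_walkIncrement

lemma measurable_laterVisits (hS : IsGroupRandomWalk P S) (n i : ℕ) :
    Measurable (laterVisits S n i) :=
  (measurable_returnCount _).comp ((measurable_shiftSeq i).comp hS.measurable_increments)

/-- Both sides are infinite product measures with the same marginals. -/
lemma map_shiftSeq (hS : IsGroupRandomWalk P S) (i : ℕ) :
    P.map (fun ω => shiftSeq i fun j => walkIncrement S j ω) =
      P.map fun ω j => walkIncrement S j ω := by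
  have h1 := hS.indep.map_fun_eq_infinitePi_map hS.measurable_walkIncrement
  have h2 := (hS.indep.precomp (add_right_injective i)).map_fun_eq_infinitePi_map
    fun j => hS.measurable_walkIncrement (i + j)
  rw [h1]
  refine Eq.trans h2 ?_
  congr 1
  ext1 j
  exact (hS.identDistrib (i + j)).map_eq.trans (hS.identDistrib j).map_eq.symm

lemma measure_shiftSeq_mem (hS : IsGroupRandomWalk P S) (i : ℕ) {A : Set (ℕ → G)}
    (hA : MeasurableSet A) :
    P {ω | (shiftSeq i fun j => walkIncrement S j ω) ∈ A} =
      P {ω | (fun j => walkIncrement S j ω) ∈ A} := by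
  have h := congrArg (fun μ => μ A) (hS.map_shiftSeq i)
  have hi : Measurable fun ω => shiftSeq i fun j => walkIncrement S j ω :=
    (measurable_shiftSeq i).comp hS.measurable_increments
  rwa [Measure.map_apply hi hA,
    Measure.map_apply hS.measurable_increments hA] at h

/-- An event about the first `k` increments is independent of the later increments. -/
lemma measure_inter_shiftSeq_mem (hS : IsGroupRandomWalk P S) (k : ℕ) {A B : Set (ℕ → G)}
    (hA : MeasurableSet A) (hAk : ∀ s t : ℕ → G, (∀ j < k, s j = t j) → s ∈ A → t ∈ A)
    (hB : MeasurableSet B) :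
    P ({ω | (fun j => walkIncrement S j ω) ∈ A} ∩
        {ω | (shiftSeq k fun j => walkIncrement S j ω) ∈ B}) =
      P {ω | (fun j => walkIncrement S j ω) ∈ A} *
        P {ω | (fun j => walkIncrement S j ω) ∈ B} := by
  rw [← hS.measure_shiftSeq_mem k hB]
  have hind := indep_iSup_of_disjoint (fun i => (hS.measurable_walkIncrement i).comap_le)
    hS.indep.iIndep (Set.disjoint_left.2 fun j (hj : j ∈ Set.Iio k) (hj' : j ∈ Set.Ici k) =>
      absurd (Set.mem_Iio.1 hj) (not_lt.2 hj'))
  refine (Indep_iff _ _ P).1 hind _ _ ?_ ?_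
  -- Replacing every letter from index `k` on by `1` does not affect membership in `A`, and the
  -- modified sequence is measurable for the first `k` increments.
  · have h : {ω | (fun j => walkIncrement S j ω) ∈ A} =
        (fun ω (j : ℕ) => if j < k then walkIncrement S j ω else 1) ⁻¹' A := by
      ext ω
      exact ⟨hAk _ _ fun j hj => by simp [hj], hAk _ _ fun j hj => by simp [hj]⟩
    rw [h]
    refine measurable_pi_of_comap_le (fun j => ?_) hA
    by_cases hj : j < k
    · simp only [if_pos hj]
      exact le_biSup (fun i => MeasurableSpace.comap (walkIncrement S i) inferInstance)
        (Set.mem_Iio.2 hj)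
    · simp only [if_neg hj, MeasurableSpace.comap_const, bot_le]
  · refine measurable_pi_of_comap_le (X := fun ω => shiftSeq k fun j => walkIncrement S j ω)
      (fun j => ?_) hB
    exact le_biSup (fun i => MeasurableSpace.comap (walkIncrement S i) inferInstance)
      (Set.mem_Ici.2 (Nat.le_add_right k j))

end IsGroupRandomWalk

/-- The sequences of letters whose partial products return to `1` at least `b` times. -/
def returnsAtLeast (G : Type*) [Group G] (b : ℕ) : Set (ℕ → G) :=
  {s | ∃ m, b ≤ returnCount m s}

lemma measurableSet_le_returnCount (b m : ℕ) :
    MeasurableSet {s : ℕ → G | b ≤ returnCount m s} :=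
  measurable_returnCount m measurableSet_Ici

lemma measurableSet_returnsAtLeast (b : ℕ) : MeasurableSet (returnsAtLeast G b) := by
  have : returnsAtLeast G b = ⋃ m, {s | b ≤ returnCount m s} := by
    ext; simp [returnsAtLeast]
  rw [this]
  exact MeasurableSet.iUnion fun m => measurableSet_le_returnCount b m

/-- The sequences of letters whose partial products first return to `1` at time `k + 1`. -/
def firstReturnAt (G : Type*) [Group G] (k : ℕ) : Set (ℕ → G) :=
  {s | returnCount k s = 0 ∧ wordProd s (k + 1) = 1}

lemma measurableSet_firstReturnAt (k : ℕ) : MeasurableSet (firstReturnAt G k) :=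
  (measurable_returnCount k (MeasurableSet.of_discrete (s := {0}))).inter
    (measurable_wordProd (k + 1) (MeasurableSet.of_discrete (s := {1})))

lemma firstReturnAt_congr {G : Type*} [Group G] {k : ℕ} (s t : ℕ → G)
    (h : ∀ j < k + 1, s j = t j) (hs : s ∈ firstReturnAt G k) : t ∈ firstReturnAt G k := by
  refine ⟨?_, ?_⟩
  · rw [← returnCount_congr fun j hj => h j (by omega)]; exact hs.1
  · rw [← wordProd_congr h]; exact hs.2

lemma returnCount_of_firstReturnAt {G : Type*} [Group G] {k : ℕ} {s : ℕ → G}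
    (hs : s ∈ firstReturnAt G k) (m : ℕ) :
    returnCount (k + 1 + m) s = 1 + returnCount m (shiftSeq (k + 1) s) := by
  classical
  rw [returnCount_add_of_wordProd_eq_one hs.2, returnCount_succ, hs.1, if_pos hs.2]

lemma disjoint_firstReturnAt {G : Type*} [Group G] {k l : ℕ} (h : k ≠ l) :
    Disjoint (firstReturnAt G k) (firstReturnAt G l) := by
  wlog hkl : k < l generalizing k l
  · exact (this h.symm (by omega)).symm
  refine Set.disjoint_left.2 fun s hk hl => ?_
  have h1 := returnCount_of_firstReturnAt hk 0
  have h2 : returnCount (k + 1 + 0) s ≤ returnCount l s := returnCount_mono s (by omega)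
  rw [hl.1] at h2
  omega

lemma exists_firstReturnAt {G : Type*} [Group G] {s : ℕ → G} {m : ℕ}
    (h : 1 ≤ returnCount m s) : ∃ k < m, s ∈ firstReturnAt G k := by
  classical
  induction m with
  | zero => simp [returnCount_zero] at h
  | succ m ih =>
    by_cases hm : 1 ≤ returnCount m s
    · obtain ⟨k, hk, hs⟩ := ih hm
      exact ⟨k, by omega, hs⟩
    · rw [returnCount_succ] at h
      refine ⟨m, by omega, by omega, ?_⟩
      by_contra hne
      rw [if_neg hne] at h
      omega

/-- After the first return the word starts afresh, and one return has already been used. This is the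
pathwise form of the Markov property at the first return time. -/
lemma returnsAtLeast_succ {G : Type*} [Group G] (b : ℕ) :
    returnsAtLeast G (b + 1) =
      ⋃ k, firstReturnAt G k ∩ shiftSeq (k + 1) ⁻¹' returnsAtLeast G b := by
  ext s
  simp only [Set.mem_iUnion, Set.mem_inter_iff, Set.mem_preimage]
  constructor
  · rintro ⟨m, hm⟩
    obtain ⟨k, hk, hs⟩ := exists_firstReturnAt (by omega : 1 ≤ returnCount m s)
    refine ⟨k, hs, m - (k + 1), ?_⟩
    have h := returnCount_of_firstReturnAt hs (m - (k + 1))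
    rw [show k + 1 + (m - (k + 1)) = m by omega] at h
    omega
  · rintro ⟨k, hs, m, hm⟩
    exact ⟨k + 1 + m, by rw [returnCount_of_firstReturnAt hs]; omega⟩

lemma returnsAtLeast_zero {G : Type*} [Group G] : returnsAtLeast G 0 = Set.univ :=
  Set.eq_univ_of_forall fun _ => ⟨0, Nat.zero_le _⟩

lemma returnsAtLeast_one {G : Type*} [Group G] :
    returnsAtLeast G 1 = ⋃ k, firstReturnAt G k := by
  simp [returnsAtLeast_succ 0, returnsAtLeast_zero]

lemma mem_returnsAtLeast_one_iff {G : Type*} [Group G] {s : ℕ → G} :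
    s ∈ returnsAtLeast G 1 ↔ ∃ k, wordProd s (k + 1) = 1 := by
  classical
  constructor
  · rw [returnsAtLeast_one, Set.mem_iUnion]
    rintro ⟨k, hk⟩
    exact ⟨k, hk.2⟩
  · rintro ⟨k, hk⟩
    exact ⟨k + 1, by rw [returnCount_succ, if_pos hk]; omega⟩

namespace IsGroupRandomWalk

/-- The first return times give disjoint cases. In each, the first return is decided by the letters
up to that time and the remaining returns by the later ones, so the probability factors. -/
lemma measure_returnsAtLeast_succ (hS : IsGroupRandomWalk P S) (b : ℕ) :
    P {ω | (fun j => walkIncrement S j ω) ∈ returnsAtLeast G (b + 1)} =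
      P {ω | (fun j => walkIncrement S j ω) ∈ returnsAtLeast G 1} *
        P {ω | (fun j => walkIncrement S j ω) ∈ returnsAtLeast G b} := by
  have hX := hS.measurable_increments
  have h1 : {ω | (fun j => walkIncrement S j ω) ∈ returnsAtLeast G (b + 1)} =
      ⋃ k, {ω | (fun j => walkIncrement S j ω) ∈ firstReturnAt G k} ∩
        {ω | (shiftSeq (k + 1) fun j => walkIncrement S j ω) ∈ returnsAtLeast G b} := by
    ext ω
    simp [returnsAtLeast_succ]
  have h2 : {ω | (fun j => walkIncrement S j ω) ∈ returnsAtLeast G 1} =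
      ⋃ k, {ω | (fun j => walkIncrement S j ω) ∈ firstReturnAt G k} := by
    ext ω
    simp [returnsAtLeast_one]
  have hdisj : Pairwise (Function.onFun Disjoint
      fun k => {ω | (fun j => walkIncrement S j ω) ∈ firstReturnAt G k}) :=
    fun k l hkl => (disjoint_firstReturnAt hkl).preimage _
  have hmeas : ∀ k, MeasurableSet {ω | (fun j => walkIncrement S j ω) ∈ firstReturnAt G k} :=
    fun k => hX (measurableSet_firstReturnAt k)
  rw [h1, h2, measure_iUnion hdisj hmeas, measure_iUnion, ← ENNReal.tsum_mul_right]
  · refine tsum_congr fun k => ?_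
    exact hS.measure_inter_shiftSeq_mem (k + 1) (measurableSet_firstReturnAt k)
      firstReturnAt_congr (measurableSet_returnsAtLeast b)
  · exact fun k l hkl => (hdisj hkl).mono Set.inter_subset_left Set.inter_subset_left
  · exact fun k => (hmeas k).inter
      ((measurable_shiftSeq (k + 1)).comp hX (measurableSet_returnsAtLeast b))

/-- The number of returns to the identity is geometric. -/
lemma measureReal_returnsAtLeast [IsProbabilityMeasure P] (hS : IsGroupRandomWalk P S) (b : ℕ) :
    P.real {ω | (fun j => walkIncrement S j ω) ∈ returnsAtLeast G b} =
      (1 - escapeProb P S) ^ b := by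
  have hone : P.real {ω | (fun j => walkIncrement S j ω) ∈ returnsAtLeast G 1} =
      1 - escapeProb P S := by
    have hm : MeasurableSet {ω | (fun j => walkIncrement S j ω) ∈ returnsAtLeast G 1} :=
      hS.measurable_increments (measurableSet_returnsAtLeast 1)
    have h : escapeProb P S =
        P.real {ω | (fun j => walkIncrement S j ω) ∈ returnsAtLeast G 1}ᶜ := by
      -- The walk starts at `1` only almost surely, so the two events agree up to a null set.
      refine measureReal_congr ?_
      filter_upwards [hS.start] with ω hω
      refine propext ?_
      change (∀ n, 1 ≤ n → S n ω ≠ 1) ↔ ¬ _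
      have hw : ∀ k, wordProd (fun j => walkIncrement S j ω) k = S k ω := fun k => by
        have := wordProd_walkIncrement S ω 0 k
        have h0 : (shiftSeq 0 fun j => walkIncrement S j ω) = fun j => walkIncrement S j ω := by
          ext j; simp [shiftSeq]
        rwa [hω, one_mul, zero_add, h0] at this
      rw [Set.mem_ofPred_eq, mem_returnsAtLeast_one_iff]
      simp only [hw, not_exists]
      exact ⟨fun h k => h (k + 1) (by omega), fun h n hn => by
        obtain ⟨k, rfl⟩ : ∃ k, n = k + 1 := ⟨n - 1, by omega⟩
        exact h k⟩
    rw [h, probReal_compl_eq_one_sub hm]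
    ring
  induction b with
  | zero => simp [returnsAtLeast_zero]
  | succ b ih =>
    rw [measureReal_def, measure_returnsAtLeast_succ hS, ENNReal.toReal_mul, pow_succ',
      ← ih, ← hone]
    rfl

/-- Within the first `m` steps, the return counts approximate the total number of returns. -/
lemma tendsto_measureReal_le_returnCount [IsProbabilityMeasure P] (hS : IsGroupRandomWalk P S)
    (b : ℕ) :
    Tendsto (fun m => P.real {ω | b ≤ returnCount m fun j => walkIncrement S j ω}) atTop
      (𝓝 ((1 - escapeProb P S) ^ b)) := by
  rw [← hS.measureReal_returnsAtLeast]
  have h := tendsto_measure_iUnion_atTop (μ := P)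
    (s := fun m => {ω | b ≤ returnCount m fun j => walkIncrement S j ω})
    fun m n hmn ω hω => le_trans (Set.mem_ofPred.1 hω) (returnCount_mono _ hmn)
  have h' : ⋃ m, {ω | b ≤ returnCount m fun j => walkIncrement S j ω} =
      {ω | (fun j => walkIncrement S j ω) ∈ returnsAtLeast G b} := by
    ext; simp [returnsAtLeast]
  rw [h'] at h
  exact (ENNReal.tendsto_toReal (measure_ne_top _ _)).comp h

end IsGroupRandomWalk

end Law

/-! ### Second moments of the counts of later visits -/

section Moments

lemma eLpNorm_two_eq_ofReal_sqrt {Ω : Type*} [MeasurableSpace Ω] {P : Measure Ω} {X : Ω → ℝ}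
    (hX : MemLp X 2 P) : eLpNorm X 2 P = ENNReal.ofReal (√(∫ ω, X ω ^ 2 ∂P)) := by
  rw [hX.eLpNorm_eq_integral_rpow_norm (by simp) (by simp)]
  simp [Real.sqrt_eq_rpow]

/-- Counts the times too close to `i` for approximate independence; their pair probabilities are
bounded trivially by 1. -/
lemma sum_ite_near_le (n m i : ℕ) :
    ∑ j ∈ Finset.range n, (if j < i + m ∧ i < j + m then (1 : ℝ) else 0) ≤ 2 * m := by
  rw [Finset.sum_boole]
  have h : ({j ∈ Finset.range n | j < i + m ∧ i < j + m}).card ≤ 2 * m := by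
    refine (Finset.card_le_card (t := Finset.Ico (i - m) (i + m)) fun j hj => ?_).trans ?_
    · simp only [Finset.mem_filter, Finset.mem_range] at hj
      rw [Finset.mem_Ico]
      omega
    · rw [Nat.card_Ico]
      omega
  exact_mod_cast h

/-- Counts the times near the end, whose remaining horizon is shorter than `m`. -/
lemma sum_ite_end_le (n m : ℕ) :
    ∑ i ∈ Finset.range n, (if n - 1 - i < m then (1 : ℝ) else 0) ≤ m := by
  rw [Finset.sum_boole]
  have h : ({i ∈ Finset.range n | n - 1 - i < m}).card ≤ m := by
    refine (Finset.card_le_card (t := Finset.Ico (n - m) n) fun j hj => ?_).trans ?_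
    · simp only [Finset.mem_filter, Finset.mem_range] at hj
      rw [Finset.mem_Ico]
      omega
    · rw [Nat.card_Ico]
      omega
  exact_mod_cast h

lemma measureReal_le_returnCount_mono {Ω G : Type*} [MeasurableSpace Ω] [Group G]
    {P : Measure Ω} [IsProbabilityMeasure P] {S : ℕ → Ω → G} (a : ℕ) {k m : ℕ} (h : k ≤ m) :
    P.real {ω | a ≤ returnCount k fun j => walkIncrement S j ω} ≤
      P.real {ω | a ≤ returnCount m fun j => walkIncrement S j ω} :=
  measureReal_mono fun _ hω => le_trans (Set.mem_ofPred.1 hω) (returnCount_mono _ h)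

variable {Ω G : Type*} [MeasurableSpace Ω] [Group G] [Countable G] [MeasurableSpace G]
  [DiscreteMeasurableSpace G] {P : Measure Ω} {S : ℕ → Ω → G}

/-- The number of times before `n` after which the current site is visited at least `a` more times
before time `n`. -/
noncomputable def countLaterVisits (S : ℕ → Ω → G) (a n : ℕ) (ω : Ω) : ℝ :=
  ∑ i ∈ Finset.range n, {ω | a ≤ laterVisits S n i ω}.indicator (fun _ => (1 : ℝ)) ω

namespace IsGroupRandomWalk

lemma measurableSet_le_laterVisits (hS : IsGroupRandomWalk P S) (a n i : ℕ) :
    MeasurableSet {ω | a ≤ laterVisits S n i ω} :=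
  hS.measurable_laterVisits n i measurableSet_Ici

lemma measureReal_le_laterVisits (hS : IsGroupRandomWalk P S) (a n i : ℕ) :
    P.real {ω | a ≤ laterVisits S n i ω} =
      P.real {ω | a ≤ returnCount (n - 1 - i) fun j => walkIncrement S j ω} :=
  congrArg ENNReal.toReal (hS.measure_shiftSeq_mem i (measurableSet_le_returnCount a (n - 1 - i)))

variable [IsProbabilityMeasure P]

lemma memLp_comp_laterVisits (hS : IsGroupRandomWalk P S) (h : ℕ → ℝ) (n i : ℕ)
    (p : ENNReal) : MemLp (fun ω => h (laterVisits S n i ω)) p P := by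
  refine MemLp.of_bound
    ((Measurable.of_discrete (f := h)).comp (hS.measurable_laterVisits n i)).aestronglyMeasurable
    (∑ b ∈ Finset.range (n + 1), ‖h b‖) (Eventually.of_forall fun ω => ?_)
  refine Finset.single_le_sum (f := fun b => ‖h b‖) (fun b _ => norm_nonneg _) ?_
  have := returnCount_le (n - 1 - i) (shiftSeq i fun j => walkIncrement S j ω)
  rw [Finset.mem_range]
  change returnCount _ _ < _
  omega

lemma measureReal_le_returnCount_le (hS : IsGroupRandomWalk P S) (a m : ℕ) :
    P.real {ω | a ≤ returnCount m fun j => walkIncrement S j ω} ≤ (1 - escapeProb P S) ^ a := by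
  rw [← hS.measureReal_returnsAtLeast]
  exact measureReal_mono fun ω hω => ⟨m, hω⟩

/-- Since h ≥ 0, h(L) is one of the terms of ∑_b h(b) 1_{b ≤ L}; only the geometric tail bound is
then needed, not the exact law of L. -/
lemma integral_comp_laterVisits_le (hS : IsGroupRandomWalk P S) (h : ℕ → ℝ) (hh : ∀ b, 0 ≤ h b)
    {n i : ℕ} (hi : i < n) :
    ∫ ω, h (laterVisits S n i ω) ∂P ≤
      ∑ b ∈ Finset.range n, h b * (1 - escapeProb P S) ^ b := by
  have hint : ∀ b ∈ Finset.range n, Integrable (fun ω =>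
      h b * {ω | b ≤ laterVisits S n i ω}.indicator (fun _ => (1 : ℝ)) ω) P := fun b _ =>
    ((integrable_const (1 : ℝ)).indicator (hS.measurableSet_le_laterVisits b n i)).const_mul _
  calc ∫ ω, h (laterVisits S n i ω) ∂P
      ≤ ∫ ω, ∑ b ∈ Finset.range n,
          h b * {ω | b ≤ laterVisits S n i ω}.indicator (fun _ => (1 : ℝ)) ω ∂P := by
        refine integral_mono (memLp_one_iff_integrable.1 (hS.memLp_comp_laterVisits h n i 1))
          (integrable_finsetSum _ hint) fun ω => ?_
        refine le_trans (le_of_eq ?_) (Finset.single_le_sum (f := fun b =>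
          h b * {ω | b ≤ laterVisits S n i ω}.indicator (fun _ => (1 : ℝ)) ω)
          (fun b _ => mul_nonneg (hh b) (Set.indicator_nonneg (fun _ _ => zero_le_one) _))
          (Finset.mem_range.2 (laterVisits_lt S hi ω)))
        simp
    _ = ∑ b ∈ Finset.range n, h b * P.real {ω | b ≤ laterVisits S n i ω} := by
        rw [integral_finsetSum _ hint]
        refine Finset.sum_congr rfl fun b _ => ?_
        rw [integral_const_mul, integral_indicator_const _ (hS.measurableSet_le_laterVisits b n i)]
        simp
    _ ≤ _ := by
        refine Finset.sum_le_sum fun b _ => mul_le_mul_of_nonneg_left ?_ (hh b)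
        rw [hS.measureReal_le_laterVisits]
        exact hS.measureReal_le_returnCount_le b _

/-- The events of having many later returns are asymptotically independent. -/
lemma measureReal_inter_le (hS : IsGroupRandomWalk P S) (a n m : ℕ) {i j : ℕ} (hij : i + m ≤ j) :
    P.real ({ω | a ≤ laterVisits S n i ω} ∩ {ω | a ≤ laterVisits S n j ω}) ≤
      ((1 - escapeProb P S) ^ a) ^ 2 + ((1 - escapeProb P S) ^ a -
        P.real {ω | a ≤ returnCount m fun j => walkIncrement S j ω}) := by
  obtain ⟨k, rfl⟩ : ∃ k, j = i + k := ⟨j - i, by omega⟩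
  have hmk : m ≤ k := by omega
  set X : Ω → ℕ → G := fun ω j => walkIncrement S j ω with hX
  have hR := measurableSet_le_returnCount (G := G) a m
  have hE := measurableSet_returnsAtLeast (G := G) a
  have hRE : {s : ℕ → G | a ≤ returnCount m s} ⊆ returnsAtLeast G a := fun s hs => ⟨m, hs⟩
  have hp := hS.measureReal_le_returnCount_le a m
  have hq : 0 ≤ (1 - escapeProb P S) ^ a := by
    rw [← hS.measureReal_returnsAtLeast]; exact measureReal_nonneg
  have h1 : P.real {ω | shiftSeq i (X ω) ∈
      {s : ℕ → G | a ≤ returnCount m s} ∩ shiftSeq k ⁻¹' returnsAtLeast G a} =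
      P.real {ω | a ≤ returnCount m (X ω)} * (1 - escapeProb P S) ^ a := by
    rw [← hS.measureReal_returnsAtLeast, measureReal_def,
      hS.measure_shiftSeq_mem i (hR.inter (measurable_shiftSeq k hE)), measureReal_def,
      measureReal_def, ← ENNReal.toReal_mul]
    refine congrArg ENNReal.toReal ?_
    refine hS.measure_inter_shiftSeq_mem k hR (fun s t hst hs => ?_) hE
    rw [Set.mem_ofPred] at hs ⊢
    rwa [← returnCount_congr fun j hj => hst j (by omega)]
  have h2 : P.real {ω | shiftSeq i (X ω) ∈ returnsAtLeast G a \ {s | a ≤ returnCount m s}} =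
      (1 - escapeProb P S) ^ a - P.real {ω | a ≤ returnCount m (X ω)} := by
    rw [measureReal_def, hS.measure_shiftSeq_mem i (hE.diff hR), ← measureReal_def,
      ← hS.measureReal_returnsAtLeast]
    exact measureReal_sdiff (fun ω hω => hRE hω) (hS.measurable_increments hR)
  -- Either the `a` returns after time `i` already occur within `m ≤ k` steps, which is independent
  -- of everything after time `i + k`, or they occur eventually but not within `m` steps. The
  -- horizon `n` is discarded in favour of returns at any later time.
  calc P.real ({ω | a ≤ laterVisits S n i ω} ∩ {ω | a ≤ laterVisits S n (i + k) ω})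
      ≤ P.real ({ω | shiftSeq i (X ω) ∈
          {s : ℕ → G | a ≤ returnCount m s} ∩ shiftSeq k ⁻¹' returnsAtLeast G a} ∪
          {ω | shiftSeq i (X ω) ∈ returnsAtLeast G a \ {s | a ≤ returnCount m s}}) := by
        refine measureReal_mono fun ω hω => ?_
        by_cases hm : a ≤ returnCount m (shiftSeq i (X ω))
        · refine Or.inl ⟨hm, n - 1 - (i + k), ?_⟩
          rw [shiftSeq_shiftSeq]
          exact hω.2
        · exact Or.inr ⟨⟨n - 1 - i, hω.1⟩, hm⟩
    _ ≤ _ := measureReal_union_le _ _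
    _ ≤ _ := by
        rw [h1, h2, sq]
        gcongr

lemma memLp_countLaterVisits (hS : IsGroupRandomWalk P S) (a n : ℕ) (p : ENNReal) :
    MemLp (countLaterVisits S a n) p P :=
  memLp_finsetSum _ fun i _ => memLp_indicator_const p (hS.measurableSet_le_laterVisits a n i)
    1 (Or.inr (measure_ne_top _ _))

lemma integral_countLaterVisits (hS : IsGroupRandomWalk P S) (a n : ℕ) :
    ∫ ω, countLaterVisits S a n ω ∂P =
      ∑ i ∈ Finset.range n, P.real {ω | a ≤ laterVisits S n i ω} := by
  unfold countLaterVisits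
  rw [integral_finsetSum _ fun i _ =>
    (integrable_const (1 : ℝ)).indicator (hS.measurableSet_le_laterVisits a n i)]
  refine Finset.sum_congr rfl fun i _ => ?_
  rw [integral_indicator_const _ (hS.measurableSet_le_laterVisits a n i)]
  simp

lemma integral_countLaterVisits_sq (hS : IsGroupRandomWalk P S) (a n : ℕ) :
    ∫ ω, countLaterVisits S a n ω ^ 2 ∂P = ∑ i ∈ Finset.range n, ∑ j ∈ Finset.range n,
      P.real ({ω | a ≤ laterVisits S n i ω} ∩ {ω | a ≤ laterVisits S n j ω}) := by
  have hm := fun i => hS.measurableSet_le_laterVisits a n i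
  have h : ∀ ω, countLaterVisits S a n ω ^ 2 = ∑ i ∈ Finset.range n, ∑ j ∈ Finset.range n,
      ({ω | a ≤ laterVisits S n i ω} ∩ {ω | a ≤ laterVisits S n j ω}).indicator
        (fun _ => (1 : ℝ)) ω := fun ω => by
    rw [countLaterVisits, sq, Finset.sum_mul_sum]
    refine Finset.sum_congr rfl fun i _ => Finset.sum_congr rfl fun j _ => ?_
    rw [← Set.indicator_indicator]
    by_cases h : a ≤ laterVisits S n i ω <;> simp [h]
  have hint : ∀ i j, Integrable (({ω | a ≤ laterVisits S n i ω} ∩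
      {ω | a ≤ laterVisits S n j ω}).indicator fun _ => (1 : ℝ)) P := fun i j =>
    (integrable_const (1 : ℝ)).indicator ((hm i).inter (hm j))
  simp_rw [h]
  rw [integral_finsetSum _ fun i _ => integrable_finsetSum _ fun j _ => hint i j]
  refine Finset.sum_congr rfl fun i _ => ?_
  rw [integral_finsetSum _ fun j _ => hint i j]
  refine Finset.sum_congr rfl fun j _ => ?_
  rw [integral_indicator_const _ ((hm i).inter (hm j))]
  simp

/-- The window `m` trades two errors: times near the end or near each other cost O(m/n), while
returns later than `m` steps cost the gap between the geometric tail and its truncation. -/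
lemma integral_countLaterVisits_div_sub_sq_le (hS : IsGroupRandomWalk P S) (a m : ℕ) {n : ℕ}
    (hn : 0 < n) :
    ∫ ω, (countLaterVisits S a n ω / n - (1 - escapeProb P S) ^ a) ^ 2 ∂P ≤
      4 * m / n + 3 * ((1 - escapeProb P S) ^ a -
        P.real {ω | a ≤ returnCount m fun j => walkIncrement S j ω}) := by
  have hp := hS.measureReal_le_returnCount_le a m
  set c := (1 - escapeProb P S) ^ a with hc
  set p := P.real {ω | a ≤ returnCount m fun j => walkIncrement S j ω} with hpdef
  have hc0 : 0 ≤ c := by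
    rw [hc, ← hS.measureReal_returnsAtLeast]; exact measureReal_nonneg
  have hc1 : c ≤ 1 := by
    rw [hc, ← hS.measureReal_returnsAtLeast]; exact measureReal_le_one
  have hn' : (0 : ℝ) < n := Nat.cast_pos.2 hn
  have hfirst : n * p - m ≤ ∫ ω, countLaterVisits S a n ω ∂P := by
    rw [hS.integral_countLaterVisits]
    have h : ∑ i ∈ Finset.range n, (p - if n - 1 - i < m then (1 : ℝ) else 0) ≤
        ∑ i ∈ Finset.range n, P.real {ω | a ≤ laterVisits S n i ω} := by
      refine Finset.sum_le_sum fun i _ => ?_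
      split_ifs with h
      · have h1 : p ≤ 1 := measureReal_le_one
        have h2 : 0 ≤ P.real {ω | a ≤ laterVisits S n i ω} := measureReal_nonneg
        linarith
      · rw [sub_zero, hS.measureReal_le_laterVisits]
        exact measureReal_le_returnCount_mono a (by omega)
    rw [Finset.sum_sub_distrib, Finset.sum_const, Finset.card_range, nsmul_eq_mul] at h
    linarith [sum_ite_end_le n m]
  have hsecond : ∫ ω, countLaterVisits S a n ω ^ 2 ∂P ≤ n * (n * (c ^ 2 + (c - p)) + 2 * m) := by
    rw [hS.integral_countLaterVisits_sq]
    have h : ∀ i ∈ Finset.range n, ∑ j ∈ Finset.range n,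
        P.real ({ω | a ≤ laterVisits S n i ω} ∩ {ω | a ≤ laterVisits S n j ω}) ≤
        n * (c ^ 2 + (c - p)) + 2 * m := by
      intro i _
      have h : ∑ j ∈ Finset.range n,
          P.real ({ω | a ≤ laterVisits S n i ω} ∩ {ω | a ≤ laterVisits S n j ω}) ≤
          ∑ j ∈ Finset.range n,
            ((c ^ 2 + (c - p)) + if j < i + m ∧ i < j + m then (1 : ℝ) else 0) := by
        refine Finset.sum_le_sum fun j _ => ?_
        split_ifs with hij
        · have h1 : P.real ({ω | a ≤ laterVisits S n i ω} ∩ {ω | a ≤ laterVisits S n j ω}) ≤ 1 :=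
            measureReal_le_one
          nlinarith
        · rw [add_zero]
          rcases le_or_gt (i + m) j with h1 | h1
          · exact hS.measureReal_inter_le a n m h1
          · rw [Set.inter_comm]
            exact hS.measureReal_inter_le a n m (by omega)
      rw [Finset.sum_add_distrib, Finset.sum_const, Finset.card_range, nsmul_eq_mul] at h
      linarith [sum_ite_near_le n m i]
    refine (Finset.sum_le_sum h).trans (le_of_eq ?_)
    rw [Finset.sum_const, Finset.card_range, nsmul_eq_mul]
  have hexp : ∫ ω, (countLaterVisits S a n ω / n - c) ^ 2 ∂P =
      (∫ ω, countLaterVisits S a n ω ^ 2 ∂P) / n ^ 2 -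
        2 * c / n * ∫ ω, countLaterVisits S a n ω ∂P + c ^ 2 := by
    have hint1 : Integrable (fun ω => countLaterVisits S a n ω) P :=
      memLp_one_iff_integrable.1 (hS.memLp_countLaterVisits a n 1)
    have hint2 : Integrable (fun ω => countLaterVisits S a n ω ^ 2) P :=
      (hS.memLp_countLaterVisits a n 2).integrable_sq
    have h : ∀ ω, (countLaterVisits S a n ω / n - c) ^ 2 =
        countLaterVisits S a n ω ^ 2 / n ^ 2 - 2 * c / n * countLaterVisits S a n ω + c ^ 2 :=
      fun ω => by ring
    simp_rw [h]
    have hint3 : Integrable (fun ω => countLaterVisits S a n ω ^ 2 / (n : ℝ) ^ 2 -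
        2 * c / n * countLaterVisits S a n ω) P := (hint2.div_const _).sub (hint1.const_mul _)
    rw [integral_add hint3 (integrable_const _),
      integral_sub (hint2.div_const _) (hint1.const_mul _), integral_div, integral_const_mul]
    simp
  rw [hexp]
  have h1 : (∫ ω, countLaterVisits S a n ω ^ 2 ∂P) / n ^ 2 ≤ c ^ 2 + (c - p) + 2 * m / n := by
    rw [div_le_iff₀ (by positivity)]
    refine hsecond.trans (le_of_eq ?_)
    field_simp
  have h2 : 2 * c * p - 2 * m / n ≤ 2 * c / n * ∫ ω, countLaterVisits S a n ω ∂P := by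
    refine le_trans ?_ (mul_le_mul_of_nonneg_left hfirst (by positivity))
    have h3 : 2 * c / n * (n * p - m) = 2 * c * p - c * (2 * m / n) := by field_simp
    have h4 : (0 : ℝ) ≤ 2 * m / n := by positivity
    rw [h3]
    nlinarith
  -- Apart from the terms in m/n, the bounds add up to 2c(c - p) + (c - p), which is at most 3(c -
  -- p) because c ≤ 1.
  have h5 : c * (c - p) ≤ 1 * (c - p) := mul_le_mul_of_nonneg_right hc1 (by linarith)
  have h6 : (4 : ℝ) * m / n = 2 * m / n + 2 * m / n := by ring
  rw [h6]
  nlinarith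

lemma tendsto_eLpNorm_countLaterVisits (hS : IsGroupRandomWalk P S) (a : ℕ) :
    Tendsto (fun n : ℕ => eLpNorm
      (fun ω => countLaterVisits S a n ω / n - (1 - escapeProb P S) ^ a) 2 P) atTop (𝓝 0) := by
  have hmem : ∀ n : ℕ, MemLp
      (fun ω => countLaterVisits S a n ω / n - (1 - escapeProb P S) ^ a) 2 P := fun n => by
    simp_rw [div_eq_inv_mul]
    exact ((hS.memLp_countLaterVisits a n 2).const_mul _).sub (memLp_const _)
  simp_rw [fun n => eLpNorm_two_eq_ofReal_sqrt (hmem n)]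
  have hlim : Tendsto (fun n : ℕ =>
      ∫ ω, (countLaterVisits S a n ω / n - (1 - escapeProb P S) ^ a) ^ 2 ∂P) atTop (𝓝 0) := by
    refine Metric.tendsto_atTop.2 fun ε hε => ?_
    have h1 := hS.tendsto_measureReal_le_returnCount a
    -- The window is fixed first, so that three times the gap is below ε/2; only then does n grow to
    -- make 4m/n small.
    obtain ⟨m, hm⟩ := (h1.eventually (lt_mem_nhds
      (show (1 - escapeProb P S) ^ a - ε / 6 < (1 - escapeProb P S) ^ a by linarith))).exists
    have h2 : Tendsto (fun n : ℕ => 4 * (m : ℝ) / n) atTop (𝓝 0) :=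
      tendsto_const_div_atTop_nhds_zero_nat _
    obtain ⟨N, hN⟩ := eventually_atTop.1
      (h2.eventually (gt_mem_nhds (show (0 : ℝ) < ε / 2 by linarith)))
    refine ⟨N + 1, fun n hn => ?_⟩
    have h3 := hS.integral_countLaterVisits_div_sub_sq_le a m (show 0 < n by omega)
    have h4 := hN n (by omega)
    rw [Real.dist_eq, sub_zero, abs_of_nonneg (integral_nonneg fun ω => sq_nonneg _)]
    linarith
  have := ENNReal.tendsto_ofReal (hlim.sqrt)
  simpa using this

end IsGroupRandomWalk

end Moments

/-! ### The L² bound uniform in n -/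

namespace IsGroupRandomWalk

variable {Ω G : Type*} [MeasurableSpace Ω] [Group G] [Countable G] [MeasurableSpace G]
  [DiscreteMeasurableSpace G] {P : Measure Ω} [IsProbabilityMeasure P] {S : ℕ → Ω → G}

lemma memLp_localTimeFunctional (hS : IsGroupRandomWalk P S) (F : ℕ → ℝ) (hF : F 0 = 0) (n : ℕ)
    (p : ENNReal) : MemLp (fun ω => localTimeFunctional S F n ω / (n : ℝ)) p P := by
  simp_rw [localTimeFunctional_eq_sum S F hF, div_eq_inv_mul]
  exact (memLp_finsetSum _ fun i _ =>
    hS.memLp_comp_laterVisits (fun b => F (b + 1) - F b) n i p).const_mul _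

/-- The `L²` bound behind the summability condition. -/
lemma eLpNorm_localTimeFunctional_le (hS : IsGroupRandomWalk P S) (F : ℕ → ℝ) (hF : F 0 = 0)
    (n : ℕ) : eLpNorm (fun ω => localTimeFunctional S F n ω / (n : ℝ)) 2 P ≤
      ENNReal.ofReal (√(∑ b ∈ Finset.range n,
        F (b + 1) ^ 2 / (b + 1 : ℕ) * (1 - escapeProb P S) ^ b)) := by
  rw [eLpNorm_two_eq_ofReal_sqrt (hS.memLp_localTimeFunctional F hF n 2)]
  refine ENNReal.ofReal_le_ofReal (Real.sqrt_le_sqrt ?_)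
  rcases Nat.eq_zero_or_pos n with rfl | hn
  · simp
  set h : ℕ → ℝ := fun b => F (b + 1) ^ 2 / (b + 1 : ℕ) with hh
  have hn' : (0 : ℝ) < n := Nat.cast_pos.2 hn
  have hint : ∀ i ∈ Finset.range n, Integrable (fun ω => h (laterVisits S n i ω)) P := fun i _ =>
    memLp_one_iff_integrable.1 (hS.memLp_comp_laterVisits h n i 1)
  calc ∫ ω, (localTimeFunctional S F n ω / n) ^ 2 ∂P
      ≤ ∫ ω, (n : ℝ)⁻¹ * ∑ i ∈ Finset.range n, h (laterVisits S n i ω) ∂P := by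
        refine integral_mono (hS.memLp_localTimeFunctional F hF n 2).integrable_sq
          ((integrable_finsetSum _ hint).const_mul _) fun ω => ?_
        have h1 := localTimeFunctional_sq_le S F hF n ω
        dsimp only
        rw [div_pow, div_le_iff₀ (by positivity)]
        refine h1.trans (le_of_eq ?_)
        field_simp
        rfl
    _ = (n : ℝ)⁻¹ * ∑ i ∈ Finset.range n, ∫ ω, h (laterVisits S n i ω) ∂P := by
        rw [integral_const_mul, integral_finsetSum _ hint]
    _ ≤ (n : ℝ)⁻¹ * ∑ i ∈ Finset.range n,
          ∑ b ∈ Finset.range n, h b * (1 - escapeProb P S) ^ b := by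
        gcongr with i hi
        exact hS.integral_comp_laterVisits_le h (fun b => by positivity) (Finset.mem_range.1 hi)
    _ = _ := by
        rw [Finset.sum_const, Finset.card_range, nsmul_eq_mul, inv_mul_cancel_left₀ hn'.ne']

end IsGroupRandomWalk

/-! ### Convergence for finitely supported functions -/

/-- The number of sites visited exactly `a + 1` times. -/
lemma localTimeFunctional_ite_eq {Ω G : Type*} [Group G] (S : ℕ → Ω → G) (a n : ℕ) (ω : Ω) :
    localTimeFunctional S (fun j => if j = a + 1 then 1 else 0) n ω =
      countLaterVisits S a n ω - 2 * countLaterVisits S (a + 1) n ω +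
        countLaterVisits S (a + 2) n ω := by
  -- The time increment is 1_{v = a} - 1_{v = a + 1}, and each of these is a difference of
  -- indicators of upper tails.
  rw [localTimeFunctional_eq_sum _ _ (by simp)]
  simp only [countLaterVisits, Finset.mul_sum, ← Finset.sum_sub_distrib, ← Finset.sum_add_distrib]
  refine Finset.sum_congr rfl fun i _ => ?_
  simp only [Set.indicator_apply, Set.mem_ofPred]
  generalize laterVisits S n i ω = v
  split_ifs <;> first | omega | norm_num

lemma localTimeFunctional_eq_sum_ite {Ω G : Type*} [Group G] (S : ℕ → Ω → G) (F : ℕ → ℝ)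
    (hF : F 0 = 0) {K : ℕ} (hK : ∀ j, K < j → F j = 0) (n : ℕ) (ω : Ω) :
    localTimeFunctional S F n ω = ∑ a ∈ Finset.range K,
      F (a + 1) * localTimeFunctional S (fun j => if j = a + 1 then 1 else 0) n ω := by
  have h : ∀ v, F v = ∑ a ∈ Finset.range K, F (a + 1) * if v = a + 1 then 1 else 0 := by
    intro v
    rcases Nat.eq_zero_or_pos v with rfl | hv
    · simp [hF]
    obtain ⟨w, rfl⟩ : ∃ w, v = w + 1 := ⟨v - 1, by omega⟩
    simp only [add_left_inj, mul_ite, mul_one, mul_zero, Finset.sum_ite_eq, Finset.mem_range]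
    split_ifs with hw
    · rfl
    · exact hK _ (by omega)
  have h0 : ∀ a : ℕ, (fun j => if j = a + 1 then (1 : ℝ) else 0) 0 = 0 := fun a => by simp
  simp_rw [fun a : ℕ =>
      localTimeFunctional_eq_sum S (fun j => if j = a + 1 then (1 : ℝ) else 0) (h0 a),
     Finset.mul_sum]
  rw [localTimeFunctional_eq_sum S F hF, Finset.sum_comm]
  refine Finset.sum_congr rfl fun i _ => ?_
  rw [h (laterVisits S n i ω + 1), h (laterVisits S n i ω), ← Finset.sum_sub_distrib]
  exact Finset.sum_congr rfl fun a _ => by ring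

lemma localTimeFunctional_add {Ω G : Type*} [Group G] (S : ℕ → Ω → G) (F H : ℕ → ℝ)
    (hF : F 0 = 0) (hH : H 0 = 0) (n : ℕ) (ω : Ω) :
    localTimeFunctional S (fun j => F j + H j) n ω =
      localTimeFunctional S F n ω + localTimeFunctional S H n ω := by
  rw [localTimeFunctional_eq_sum S F hF, localTimeFunctional_eq_sum S H hH,
    localTimeFunctional_eq_sum S _ (by simp [hF, hH]), ← Finset.sum_add_distrib]
  exact Finset.sum_congr rfl fun i _ => by ring

namespace IsGroupRandomWalk

variable {Ω G : Type*} [MeasurableSpace Ω] [Group G] [Countable G] [MeasurableSpace G]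
  [DiscreteMeasurableSpace G] {P : Measure Ω} [IsProbabilityMeasure P] {S : ℕ → Ω → G}

/-- The number of sites visited exactly `a + 1` times, divided by `n`, converges in `L²`. -/
lemma tendsto_eLpNorm_localTimeFunctional_ite (hS : IsGroupRandomWalk P S) (a : ℕ) :
    Tendsto (fun n : ℕ => eLpNorm (fun ω =>
      localTimeFunctional S (fun j => if j = a + 1 then 1 else 0) n ω / (n : ℝ)
        - escapeProb P S ^ 2 * (1 - escapeProb P S) ^ a) 2 P) atTop (𝓝 0) := by
  set D : ℕ → ℕ → Ω → ℝ := fun a n ω =>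
    countLaterVisits S a n ω / n - (1 - escapeProb P S) ^ a with hD
  have hmem : ∀ a n, MemLp (D a n) 2 P := fun a n => by
    simp_rw [hD, div_eq_inv_mul]
    exact ((hS.memLp_countLaterVisits a n 2).const_mul _).sub (memLp_const _)
  -- The limits combine because q^a - 2q^(a+1) + q^(a+2) = (1 - q)² q^a with 1 - q the escape
  -- probability.
  have heq : ∀ n : ℕ, (fun ω =>
      localTimeFunctional S (fun j => if j = a + 1 then 1 else 0) n ω / (n : ℝ)
        - escapeProb P S ^ 2 * (1 - escapeProb P S) ^ a) =
      D a n - (2 : ℝ) • D (a + 1) n + D (a + 2) n := fun n => by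
    ext ω
    simp only [localTimeFunctional_ite_eq, hD, Pi.add_apply, Pi.sub_apply, Pi.smul_apply,
      smul_eq_mul]
    ring
  have hlim := ((hS.tendsto_eLpNorm_countLaterVisits a).add (ENNReal.Tendsto.const_mul
    (a := ‖(2 : ℝ)‖ₑ) (hS.tendsto_eLpNorm_countLaterVisits (a + 1)) (Or.inr (by simp)))).add
      (hS.tendsto_eLpNorm_countLaterVisits (a + 2))
  simp only [mul_zero, add_zero] at hlim
  refine tendsto_of_tendsto_of_tendsto_of_le_of_le tendsto_const_nhds hlim
    (fun _ => zero_le) fun n => ?_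
  rw [heq]
  refine (eLpNorm_add_le ((hmem a n).sub ((hmem (a + 1) n).const_smul 2)).1 (hmem (a + 2) n).1
    (by norm_num)).trans ?_
  refine add_le_add_left ((eLpNorm_sub_le (hmem a n).1 ((hmem (a + 1) n).const_smul 2).1
    (by norm_num)).trans ?_) _
  rw [eLpNorm_const_smul]

/-- The convergence for finitely supported functions. -/
lemma tendsto_eLpNorm_localTimeFunctional_of_support (hS : IsGroupRandomWalk P S) (F : ℕ → ℝ)
    (hF : F 0 = 0) {K : ℕ} (hK : ∀ j, K < j → F j = 0) :
    Tendsto (fun n : ℕ => eLpNorm (fun ω => localTimeFunctional S F n ω / (n : ℝ)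
      - escapeProb P S ^ 2 * ∑ a ∈ Finset.range K, F (a + 1) * (1 - escapeProb P S) ^ a) 2 P)
      atTop (𝓝 0) := by
  set D : ℕ → ℕ → Ω → ℝ := fun n a ω =>
    localTimeFunctional S (fun j => if j = a + 1 then 1 else 0) n ω / (n : ℝ)
      - escapeProb P S ^ 2 * (1 - escapeProb P S) ^ a with hD
  have hmem : ∀ n a, MemLp (D n a) 2 P := fun n a =>
    (hS.memLp_localTimeFunctional _ (by simp) n 2).sub (memLp_const _)
  have heq : ∀ n : ℕ, (fun ω => localTimeFunctional S F n ω / (n : ℝ)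
      - escapeProb P S ^ 2 * ∑ a ∈ Finset.range K, F (a + 1) * (1 - escapeProb P S) ^ a) =
      ∑ a ∈ Finset.range K, F (a + 1) • D n a := fun n => by
    ext ω
    simp only [localTimeFunctional_eq_sum_ite S F hF hK, hD, Finset.sum_apply, Pi.smul_apply,
      smul_eq_mul, Finset.mul_sum, Finset.sum_div, ← Finset.sum_sub_distrib]
    exact Finset.sum_congr rfl fun a _ => by ring
  have hlim := tendsto_finsetSum (Finset.range K) fun a _ => ENNReal.Tendsto.const_mul
    (a := ‖F (a + 1)‖ₑ) (hS.tendsto_eLpNorm_localTimeFunctional_ite a) (Or.inr (by simp))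
  simp only [mul_zero, Finset.sum_const_zero] at hlim
  refine tendsto_of_tendsto_of_tendsto_of_le_of_le tendsto_const_nhds hlim
    (fun _ => zero_le) fun n => ?_
  rw [heq]
  refine (eLpNorm_sum_le (fun a _ => ((hmem n a).const_smul (F (a + 1))).1) (by norm_num)).trans ?_
  refine Finset.sum_le_sum fun a _ => ?_
  rw [eLpNorm_const_smul]

end IsGroupRandomWalk

/-! ### Summability, truncation and the theorem -/

/-- By AM–GM, |f(j+1)| ≤ f(j+1)²/(j+1) + (j+1), and ∑ (j+1) q^j converges for q < 1, which is where
transience enters. -/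
lemma summable_mul_pow_of_summable_sq {f : ℕ → ℝ} {q : ℝ} (hq0 : 0 ≤ q) (hq1 : q < 1)
    (h : Summable fun j : ℕ => f (j + 1) ^ 2 / (j + 1 : ℕ) * q ^ j) :
    Summable fun j : ℕ => f (j + 1) * q ^ j := by
  have hgeo : Summable fun j : ℕ => ((j : ℝ) + 1) * q ^ j := by
    have h1 := summable_pow_mul_geometric_of_norm_lt_one 1
      (show ‖q‖ < 1 by rwa [Real.norm_of_nonneg hq0])
    have h2 := summable_geometric_of_lt_one hq0 hq1
    refine (h1.add h2).congr fun j => ?_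
    ring
  refine Summable.of_norm_bounded (h.add hgeo) fun j => ?_
  rw [norm_mul, Real.norm_of_nonneg (pow_nonneg hq0 j), ← add_mul, Real.norm_eq_abs]
  gcongr
  have hj : (0 : ℝ) < (j : ℝ) + 1 := by positivity
  push_cast
  rw [← sub_le_iff_le_add, le_div_iff₀ hj, ← sq_abs (f (j + 1))]
  nlinarith [sq_nonneg (|f (j + 1)| - ((j : ℝ) + 1)), abs_nonneg (f (j + 1))]

/-- The two series differ by a factor q. If q = 0 this factor cannot be divided out, but then only
the term j = 0 survives, as 0^0 = 1. -/
lemma summable_sq_mul_pow {f : ℕ → ℝ} {q : ℝ}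
    (h : Summable fun j : ℕ => f (j + 1) ^ 2 * q ^ (j + 1) / ((j + 1 : ℕ) : ℝ)) :
    Summable fun j : ℕ => f (j + 1) ^ 2 / (j + 1 : ℕ) * q ^ j := by
  rcases eq_or_ne q 0 with rfl | hq
  · refine summable_of_ne_finset_zero (s := {0}) fun j hj => ?_
    rw [zero_pow (by simpa using hj), mul_zero]
  · refine (h.mul_left q⁻¹).congr fun j => ?_
    field_simp
    ring

lemma sum_range_ite_le_tsum {u : ℕ → ℝ} (hu0 : ∀ b, 0 ≤ u b) (hu : Summable u) (K n : ℕ) :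
    ∑ b ∈ Finset.range n, (if b + 1 ≤ K then 0 else u b) ≤ ∑' b, u (b + K) := by
  have h0 : ∀ b, 0 ≤ if b + 1 ≤ K then 0 else u b := fun b => by
    split_ifs
    exacts [le_rfl, hu0 b]
  refine (Finset.sum_le_sum_of_subset_of_nonneg (Finset.range_mono (Nat.le_add_left n K))
    fun b _ _ => h0 b).trans ?_
  rw [Finset.sum_range_add, Finset.sum_eq_zero fun b hb =>
    if_pos (Nat.succ_le_of_lt (Finset.mem_range.1 hb)), zero_add]
  refine (Finset.sum_congr rfl fun b _ => ?_).trans_le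
    (((summable_nat_add_iff K).2 hu).sum_le_tsum (Finset.range n) fun b _ => hu0 _)
  rw [if_neg (by omega), add_comm]

theorem theorem2 {Ω G : Type*} [MeasurableSpace Ω]
    [Group G] [Countable G] [MeasurableSpace G] [DiscreteMeasurableSpace G]
    (P : Measure Ω) [IsProbabilityMeasure P]
    (S : ℕ → Ω → G) (hS : IsGroupRandomWalk P S)
    (γ : ℝ) (hγ : γ = escapeProb P S) (hγ_pos : 0 < γ)
    (f : ℕ → ℝ) (hf0 : f 0 = 0)
    (hf : Summable fun j : ℕ => f (j + 1) ^ 2 * (1 - γ) ^ (j + 1) / ((j + 1 : ℕ) : ℝ)) :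
    (Summable fun j : ℕ => f (j + 1) * (1 - γ) ^ j) ∧
    (∀ n : ℕ, MemLp (fun ω => localTimeFunctional S f n ω / (n : ℝ)) 2 P) ∧
    Tendsto
      (fun n : ℕ => eLpNorm
        (fun ω => localTimeFunctional S f n ω / (n : ℝ)
          - γ ^ 2 * ∑' j : ℕ, f (j + 1) * (1 - γ) ^ j) 2 P)
      atTop (𝓝 0) := by
  have hq0 : 0 ≤ 1 - γ := by
    rw [hγ, sub_nonneg]
    exact measureReal_le_one
  have hu := summable_sq_mul_pow hf
  have hsum := summable_mul_pow_of_summable_sq hq0 (by linarith) hu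
  refine ⟨hsum, fun n => hS.memLp_localTimeFunctional f hf0 n 2, ?_⟩
  set u : ℕ → ℝ := fun j => f (j + 1) ^ 2 / (j + 1 : ℕ) * (1 - γ) ^ j with hu_def
  set v : ℕ → ℝ := fun j => f (j + 1) * (1 - γ) ^ j with hv_def
  have hu0 : ∀ j, 0 ≤ u j := fun j => by positivity
  -- Cutting `f` at K costs two errors, both independent of n: the L² bound for the discarded part
  -- and the tail of the limiting constant.
  have htail : Tendsto (fun K => ENNReal.ofReal (√(∑' b, u (b + K))) +
      ‖γ ^ 2 * ∑' b, v (b + K)‖ₑ) atTop (𝓝 0) := by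
    have h1 := ENNReal.tendsto_ofReal (tendsto_sum_nat_add u).sqrt
    have h2 := ((tendsto_sum_nat_add v).const_mul (γ ^ 2)).enorm
    simpa using h1.add h2
  rw [ENNReal.tendsto_nhds_zero]
  intro ε hε
  have hε2 : 0 < ε / 2 := ENNReal.half_pos hε.ne'
  obtain ⟨K, hK⟩ := ((ENNReal.tendsto_nhds_zero.1 htail) (ε / 2) hε2).exists
  set F : ℕ → ℝ := fun j => if j ≤ K then f j else 0 with hF_def
  set H : ℕ → ℝ := fun j => if j ≤ K then 0 else f j with hH_def
  have hF0 : F 0 = 0 := by simp [hF_def, hf0]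
  have hH0 : H 0 = 0 := by simp [hH_def]
  have hlim := hS.tendsto_eLpNorm_localTimeFunctional_of_support F hF0 (K := K)
    fun j hj => if_neg (not_le.2 hj)
  rw [← hγ] at hlim
  filter_upwards [(ENNReal.tendsto_nhds_zero.1 hlim) (ε / 2) hε2] with n hn
  have hFsum : ∑ a ∈ Finset.range K, F (a + 1) * (1 - γ) ^ a = ∑ a ∈ Finset.range K, v a :=
    Finset.sum_congr rfl fun a ha => by
      rw [hF_def]
      simp only [if_pos (Nat.succ_le_of_lt (Finset.mem_range.1 ha)), hv_def]
  rw [hFsum] at hn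
  have hHnorm : eLpNorm (fun ω => localTimeFunctional S H n ω / (n : ℝ)) 2 P ≤
      ENNReal.ofReal (√(∑' b, u (b + K))) := by
    refine (hS.eLpNorm_localTimeFunctional_le H hH0 n).trans
      (ENNReal.ofReal_le_ofReal (Real.sqrt_le_sqrt ?_))
    refine le_trans (le_of_eq ?_) (sum_range_ite_le_tsum hu0 hu K n)
    refine Finset.sum_congr rfl fun b _ => ?_
    simp only [hH_def, hu_def, ← hγ]
    split_ifs <;> simp
  -- Splits the deviation into that of the truncated functional from its own limit, the discarded
  -- functional, and the discarded part of the constant.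
  have heq : (fun ω => localTimeFunctional S f n ω / (n : ℝ) - γ ^ 2 * ∑' j, v j) =
      ((fun ω => localTimeFunctional S F n ω / (n : ℝ) - γ ^ 2 * ∑ a ∈ Finset.range K, v a) +
        fun ω => localTimeFunctional S H n ω / (n : ℝ)) -
          fun _ => γ ^ 2 * ∑' b, v (b + K) := by
    ext ω
    have hfFH : f = fun j => F j + H j := by
      ext j
      simp only [hF_def, hH_def]
      split_ifs <;> simp
    have hG : localTimeFunctional S f n ω =
        localTimeFunctional S F n ω + localTimeFunctional S H n ω := by
      conv_lhs => rw [hfFH]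
      exact localTimeFunctional_add S F H hF0 hH0 n ω
    rw [← hsum.sum_add_tsum_nat_add K, hG]
    simp only [Pi.sub_apply, Pi.add_apply]
    ring
  have hFmem : MemLp (fun ω => localTimeFunctional S F n ω / (n : ℝ) -
      γ ^ 2 * ∑ a ∈ Finset.range K, v a) 2 P :=
    (hS.memLp_localTimeFunctional F hF0 n 2).sub (memLp_const _)
  have hHmem := hS.memLp_localTimeFunctional H hH0 n 2
  rw [heq]
  calc _ ≤ (eLpNorm (fun ω => localTimeFunctional S F n ω / (n : ℝ) -
          γ ^ 2 * ∑ a ∈ Finset.range K, v a) 2 P +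
        eLpNorm (fun ω => localTimeFunctional S H n ω / (n : ℝ)) 2 P) +
          eLpNorm (fun _ : Ω => γ ^ 2 * ∑' b, v (b + K)) 2 P :=
        (eLpNorm_sub_le (hFmem.add hHmem).1 aestronglyMeasurable_const (by norm_num)).trans
          (add_le_add_left (eLpNorm_add_le hFmem.1 hHmem.1 (by norm_num)) _)
    _ ≤ ε / 2 + ENNReal.ofReal (√(∑' b, u (b + K))) + ‖γ ^ 2 * ∑' b, v (b + K)‖ₑ := by
        refine add_le_add (add_le_add hn hHnorm) (le_of_eq ?_)
        rw [eLpNorm_const _ (by norm_num) (IsProbabilityMeasure.ne_zero P)]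
        simp
    _ ≤ ε / 2 + ε / 2 := by
        rw [add_assoc]
        exact add_le_add_right hK _
    _ = ε := ENNReal.add_halves ε
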